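/- Let $d\in\mathbb{N}$, $d\ge 1$, and $0<\beta\le 1$. Let $\mathcal{S}(\mathbb{R})$ be the space of real Schwartz functions, $\mathcal{S}'(\mathbb{R})$ its topological dual with the $\sigma$-algebra generated by the cylinder sets, and let $\mu_\beta$ be the Mittag-Leffler measure, i.e. the unique probability measure on $\mathcal{S}'(\mathbb{R})$ with $$\int_{\mathcal{S}'(\mathbb{R})} e^{i\langle\omega,\varphi\rangle}\,d\mu_\beta(\omega)=E_\beta\Big(-\tfrac12\int_{\mathbb{R}}\varphi(x)^2\,dx\Big),\quad \varphi\in\mathcal{S}(\mathbb{R}),\qquad E_\beta(z)=\sum_{n=0}^\infty\frac{z^n}{\Gamma(\beta n+1)}.$$ Let $\mathcal{S}_d(\mathbb{R})=\bigoplus_{k=1}^d\mathcal{S}(\mathbb{R})$, let $\mathcal{S}_d(\mathbb{R})_{\mathbb{C}}$ be its complexification, and let $\mathcal{S}_d'(\mathbb{R})\cong\mathcal{S}'(\mathbb{R})^d$ be its dual, carrying the product measure $\mu_\beta^{\otimes d}$; the dual pairing is extended by $\langle\omega,\varphi^1+i\varphi^2\rangle=\langle\omega,\varphi^1\rangle+i\langle\omega,\varphi^2\rangle$.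 Then for every $\varphi\in\mathcal{S}_d(\mathbb{R})_{\mathbb{C}}$ the function $\omega\mapsto e^{\langle\omega,\varphi\rangle}$ is $\mu_\beta^{\otimes d}$-integrable, and the Laplace transform $$l(\varphi)=\int_{\mathcal{S}_d'(\mathbb{R})} e^{\langle\omega,\varphi\rangle}\,d\mu_\beta^{\otimes d}(\omega),\qquad \varphi\in\mathcal{S}_d(\mathbb{R})_{\mathbb{C}},$$ is locally bounded on $\mathcal{S}_d(\mathbb{R})_{\mathbb{C}}$; it is G-holomorphic, i.e. for all $\varphi^0,\varphi\in\mathcal{S}_d(\mathbb{R})_{\mathbb{C}}$ the map $z\mapsto l(\varphi^0+z\varphi)$ is holomorphic on some neighbourhood of $0$ in $\mathbb{C}$; and it is holomorphic (G-holomorphic and continuous) on the whole space $\mathcal{S}_d(\mathbb{R})_{\mathbb{C}}$. In particular, $\mu_\beta^{\otimes d}$ satisfies condition (A1): its Laplace transform exists and is holomorphic on an open neighbourhood of zero in $\mathcal{S}_d(\mathbb{R})_{\mathbb{C}}$. -/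

import Mathlib

open MeasureTheory Topology
open scoped SchwartzMap

noncomputable section

namespace MittagLeffler

/-- The Mittag-Leffler function `E_β(z) = ∑ z ^ n / Γ(β n + 1)`; the series converges for every
complex `z` when `0 < β`. -/
def mittagLeffler (β : ℝ) (z : ℂ) : ℂ :=
  ∑' n : ℕ, z ^ n / (Real.Gamma (β * n + 1) : ℂ)

/-- The space `S(ℝ)` of real Schwartz test functions. -/
abbrev Test : Type := 𝓢(ℝ, ℝ)

/-- The space `S'(ℝ)` of real tempered distributions. -/
abbrev Distr : Type := Test →L[ℝ] ℝ

/-- The direct sum `S_d(ℝ)` of `d` copies of `S(ℝ)`. The locally convex direct sum topology of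
finitely many copies is the product topology. -/
abbrev TestD (d : ℕ) : Type := Fin d → 𝓢(ℝ, ℝ)

/-- The dual space `S_d'(ℝ)`. -/
abbrev DistrD (d : ℕ) : Type := TestD d →L[ℝ] ℝ

/-- The complexification of `S_d(ℝ)`: a complex Schwartz function is uniquely `f₁ + i f₂` with
real Schwartz functions `f₁`, `f₂`. -/
abbrev TestDC (d : ℕ) : Type := Fin d → 𝓢(ℝ, ℂ)

/-- The σ-algebra on a dual space generated by the cylinder sets, that is, the smallest one for
which all the pairings `ω ↦ ω φ` are measurable. -/
abbrev cylinderSigma (E : Type*) [AddCommGroup E] [Module ℝ E] [TopologicalSpace E] :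
    MeasurableSpace (E →L[ℝ] ℝ) :=
  ⨆ φ : E, MeasurableSpace.comap (fun ω : E →L[ℝ] ℝ => ω φ) (borel ℝ)

instance instMeasurableSpaceDistr : MeasurableSpace Distr := cylinderSigma Test

instance instMeasurableSpaceDistrD (d : ℕ) : MeasurableSpace (DistrD d) :=
  cylinderSigma (TestD d)

/-- `μ` is the Mittag-Leffler measure `μ_β`: the (unique) probability measure on `S'(ℝ)` with the
cylinder σ-algebra whose characteristic function is `φ ↦ E_β(-⟨φ, φ⟩ / 2)`. -/
def IsMittagLefflerMeasure (β : ℝ) (μ : Measure Distr) : Prop :=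
  IsProbabilityMeasure μ ∧
    ∀ φ : Test,
      ∫ ω : Distr, Complex.exp (Complex.I * ((ω φ : ℝ) : ℂ)) ∂μ =
        mittagLeffler β (((-(1 / 2) * ∫ x : ℝ, φ x * φ x : ℝ)) : ℂ)

/-- The identification of `S'(ℝ)^d` with `S_d'(ℝ)`, given by `⟨ω, φ⟩ = ∑ k, ⟨ω_k, φ_k⟩`. -/
def ofComponents (d : ℕ) (ω : Fin d → Distr) : DistrD d :=
  ∑ k : Fin d, (ω k).comp (ContinuousLinearMap.proj k)

theorem ofComponents_apply (d : ℕ) (ω : Fin d → Distr) (φ : TestD d) :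
    ofComponents d ω φ = ∑ k : Fin d, ω k (φ k) := by
  simp [ofComponents]

/-- The identification is onto, with inverse `ω ↦ (ω ∘ ι_k)_k`. -/
theorem ofComponents_single (d : ℕ) (ω : DistrD d) :
    ofComponents d (fun k => ω.comp (ContinuousLinearMap.single ℝ (fun _ : Fin d => Test) k)) =
      ω := by
  ext φ
  rw [ofComponents_apply]
  simp only [ContinuousLinearMap.comp_apply]
  rw [← map_sum]
  congr 1
  exact LinearMap.sum_single_apply (fun _ : Fin d => Test) φ

theorem measurable_eval (φ : Test) : Measurable (fun ω : Distr => ω φ) := by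
  refine Measurable.of_comap_le ?_
  rw [BorelSpace.measurable_eq (α := ℝ)]
  exact le_iSup (fun φ : Test =>
    MeasurableSpace.comap (fun ω : Distr => ω φ) (borel ℝ)) φ

theorem measurable_ofComponents (d : ℕ) : Measurable (ofComponents d) := by
  refine Measurable.of_comap_le ?_
  change MeasurableSpace.comap _ (⨆ φ : TestD d, _) ≤ _
  rw [MeasurableSpace.comap_iSup]
  refine iSup_le fun φ => ?_
  rw [MeasurableSpace.comap_comp, ← BorelSpace.measurable_eq (α := ℝ)]
  refine Measurable.comap_le ?_
  have h : ((fun ω : DistrD d => ω φ) ∘ ofComponents d) =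
      fun ω : Fin d → Distr => ∑ k : Fin d, ω k (φ k) := by
    funext ω
    exact ofComponents_apply d ω φ
  rw [h]
  exact Finset.measurable_sum _ fun k _ => (measurable_eval (φ k)).comp (measurable_pi_apply k)

/-- The `d`-fold product measure `μ^{⊗d}`, as a measure on `S_d'(ℝ) ≅ S'(ℝ)^d`. -/
def productMeasure (d : ℕ) (μ : Measure Distr) : Measure (DistrD d) :=
  (Measure.pi fun _ : Fin d => μ).map (ofComponents d)

/-- The component-wise real part `φ₁` of `φ = φ₁ + i φ₂`. -/
def rePart {d : ℕ} (φ : TestDC d) : TestD d :=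
  fun k => (φ k).postcompCLM Complex.reCLM

/-- The component-wise imaginary part `φ₂` of `φ = φ₁ + i φ₂`. -/
def imPart {d : ℕ} (φ : TestDC d) : TestD d :=
  fun k => (φ k).postcompCLM Complex.imCLM

/-- The bilinear extension `⟨ω, φ₁ + i φ₂⟩ = ⟨ω, φ₁⟩ + i ⟨ω, φ₂⟩` of the dual pairing. -/
def pairing {d : ℕ} (ω : DistrD d) (φ : TestDC d) : ℂ :=
  ((ω (rePart φ) : ℝ) : ℂ) + Complex.I * ((ω (imPart φ) : ℝ) : ℂ)

/-- The Laplace transform `l_ν(φ) = ∫ exp ⟨ω, φ⟩ dν(ω)`. -/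
def laplaceTransform {d : ℕ} (ν : Measure (DistrD d)) (φ : TestDC d) : ℂ :=
  ∫ ω : DistrD d, Complex.exp (pairing ω φ) ∂ν

section Holomorphy

variable {E : Type*} [AddCommGroup E] [Module ℂ E] [TopologicalSpace E]

/-- `f` is bounded on a neighbourhood of each point of `U`. -/
def LocallyBoundedOn (f : E → ℂ) (U : Set E) : Prop :=
  ∀ x ∈ U, ∃ C : ℝ, ∀ᶠ y in 𝓝[U] x, ‖f y‖ ≤ C

/-- `f` is G-holomorphic on `U`: for all `x ∈ U` and all directions `v`, the function
`z ↦ f (x + z v)` is holomorphic on some neighbourhood of zero in `ℂ`. -/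
def GHolomorphicOn (f : E → ℂ) (U : Set E) : Prop :=
  ∀ x ∈ U, ∀ v : E, ∃ V : Set ℂ, IsOpen V ∧ (0 : ℂ) ∈ V ∧ (∀ z ∈ V, x + z • v ∈ U) ∧
    DifferentiableOn ℂ (fun z : ℂ => f (x + z • v)) V

/-- Holomorphy on an open subset of a locally convex space: G-holomorphic and continuous. -/
def HolomorphicOn (f : E → ℂ) (U : Set E) : Prop :=
  IsOpen U ∧ GHolomorphicOn f U ∧ ContinuousOn f U

end Holomorphy

/-- Condition (A1): the Laplace transform of `ν` exists and is holomorphic on a neighbourhood of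
zero. -/
def HasAnalyticLaplaceTransform {d : ℕ} (ν : Measure (DistrD d)) : Prop :=
  ∃ U : Set (TestDC d), (0 : TestDC d) ∈ U ∧
    (∀ φ ∈ U, Integrable (fun ω : DistrD d => Complex.exp (pairing ω φ)) ν) ∧
    HolomorphicOn (laplaceTransform ν) U

end MittagLeffler

end

/-!
For a single test function `φ`, the characteristic function of `ω ↦ ω φ` is
`t ↦ E_β(-t² ⟨φ, φ⟩ / 2)`, an even entire power series `∑ aₘ t²ᵐ`. The random variable
`((2 - 2 cos (t ω φ)) / t²)ⁿ` tends to `(ω φ)²ⁿ` as `t → 0`, and its expectation is a central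
difference of order `2n` of the characteristic function divided by `t²ⁿ`, which tends to
`± (2n)! aₙ`. Fatou's lemma therefore gives `E (ω φ)²ⁿ ≤ (2n)! |aₙ|` (`lintegral_pow_two_mul_le`),
and summing the series of `cosh` shows that all exponential moments of `ω φ` are finite
(`integrable_exp_mul_abs_of_hasSum`).

For a complex test function `f = u + i v`, both `∫ exp(z ω u + i ω v) dμ_β(ω)` and
`E_β(½ ∫ (z u + i v)²)` are then entire in `z`, and they agree on the imaginary axis, where the
first is a value of the characteristic function. Hence they agree at `z = 1`
(`IsMittagLefflerMeasure.integral_exp`). By Fubini's theorem the Laplace transform of the product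
measure is `φ ↦ ∏ₖ E_β(½ ∫ φₖ²)` (`IsMittagLefflerMeasure.laplaceTransform_productMeasure`).
Continuity, hence local boundedness, follows because `f ↦ ∫ f²` is continuous on the Schwartz
space, and holomorphy along complex lines because `∫ (f + z g)²` is a quadratic polynomial in `z`.
-/

namespace MittagLeffler

open Filter

/-! ### The Mittag-Leffler function is entire -/

/-- Restricting Euler's integral to `(M, M + 1]` shows that `Γ` outgrows every geometric
sequence. -/
theorem rpow_mul_exp_neg_le_Gamma {M s : ℝ} (hM : 0 < M) (hs : 0 ≤ s) :
    M ^ s * Real.exp (-(M + 1)) ≤ Real.Gamma (s + 1) := by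
  rw [Real.Gamma_eq_integral (by linarith)]
  simp only [add_sub_cancel_right]
  have hint := Real.GammaIntegral_convergent (s := s + 1) (by linarith)
  simp only [add_sub_cancel_right] at hint
  have hsub : Set.Ioc M (M + 1) ⊆ Set.Ioi 0 := fun x hx => lt_trans hM hx.1
  calc M ^ s * Real.exp (-(M + 1))
      = ∫ _ in Set.Ioc M (M + 1), M ^ s * Real.exp (-(M + 1)) := by simp
    _ ≤ ∫ x in Set.Ioc M (M + 1), Real.exp (-x) * x ^ s := by
        refine setIntegral_mono_on (integrableOn_const (by simp)) (hint.mono_set hsub)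
          measurableSet_Ioc ?_
        intro x hx
        rw [mul_comm]
        gcongr
        · exact hx.2
        · exact hx.1.le
    _ ≤ ∫ x in Set.Ioi 0, Real.exp (-x) * x ^ s := by
        refine setIntegral_mono_set hint ?_ hsub.eventuallyLE
        filter_upwards [ae_restrict_mem measurableSet_Ioi] with x hx
        have : (0 : ℝ) < x := hx
        simp only [Pi.zero_apply]
        positivity

theorem Gamma_mul_natCast_add_one_pos {β : ℝ} (hβ : 0 < β) (n : ℕ) :
    0 < Real.Gamma (β * n + 1) := Real.Gamma_pos_of_pos (by positivity)

theorem summable_pow_div_Gamma {β : ℝ} (hβ : 0 < β) {r : ℝ} (hr : 0 ≤ r) :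
    Summable fun n : ℕ => r ^ n / Real.Gamma (β * n + 1) := by
  -- `M` is chosen such that `M ^ β = 2 * r + 1`, which makes the majorant geometric.
  set M : ℝ := (2 * r + 1) ^ β⁻¹ with hMdef
  have hM : 0 < M := by positivity
  have hMβ : M ^ β = 2 * r + 1 := Real.rpow_inv_rpow (by positivity) hβ.ne'
  have hgeo : Summable fun n : ℕ => Real.exp (M + 1) * (1 / 2 : ℝ) ^ n :=
    (summable_geometric_of_lt_one (by norm_num) (by norm_num)).mul_left _
  refine hgeo.of_nonneg_of_le
    (fun n => div_nonneg (pow_nonneg hr n) (Gamma_mul_natCast_add_one_pos hβ n).le) fun n => ?_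
  have h := rpow_mul_exp_neg_le_Gamma hM (s := β * n) (by positivity)
  rw [Real.rpow_mul hM.le, hMβ, Real.rpow_natCast] at h
  rw [div_le_iff₀ (Gamma_mul_natCast_add_one_pos hβ n)]
  calc r ^ n ≤ ((1 / 2) * (2 * r + 1)) ^ n := by gcongr; linarith
    _ = Real.exp (M + 1) * (1 / 2) ^ n * ((2 * r + 1) ^ n * Real.exp (-(M + 1))) := by
        rw [Real.exp_neg, mul_pow]
        field_simp
    _ ≤ _ := by gcongr

theorem differentiable_mittagLeffler {β : ℝ} (hβ : 0 < β) :
    Differentiable ℂ (mittagLeffler β) := by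
  intro z
  have h : DifferentiableOn ℂ (mittagLeffler β) (Metric.ball 0 (‖z‖ + 1)) := by
    refine Complex.differentiableOn_tsum_of_summable_norm
      (summable_pow_div_Gamma hβ (r := ‖z‖ + 1) (by positivity))
      (fun n => by fun_prop) Metric.isOpen_ball fun n w hw => ?_
    have hw' : ‖w‖ ≤ ‖z‖ + 1 := (mem_ball_zero_iff.1 hw).le
    have hG := Gamma_mul_natCast_add_one_pos hβ n
    rw [norm_div, norm_pow, Complex.norm_real, Real.norm_of_nonneg hG.le]
    gcongr
  exact h.differentiableAt (Metric.isOpen_ball.mem_nhds (by simp))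

/-! ### Finite differences and even moments -/

/-- Coefficients of the central difference of order `2 * n`, with the sign that makes its symbol
`(2 - 2 * cos θ) ^ n` nonnegative. -/
def centralCoeff (n k : ℕ) : ℝ := (-1) ^ n * (((-1 : ℤ) ^ (2 * n - k) * (2 * n).choose k : ℤ) : ℝ)

theorem sum_centralCoeff_mul (n : ℕ) (g : ℝ → ℝ) :
    ∑ k ∈ Finset.range (2 * n + 1), centralCoeff n k * g (k - n) =
      (-1) ^ n * (fwdDiff (1 : ℝ))^[2 * n] g (-n) := by
  rw [fwdDiff_iter_eq_sum_shift, Finset.mul_sum]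
  refine Finset.sum_congr rfl fun k _ => ?_
  rw [centralCoeff, zsmul_eq_mul, mul_assoc, nsmul_one, neg_add_eq_sub]

/-- The symbol of the central difference: the sum is the real part of
`(-1) ^ n * exp (-i n θ) * (exp (i θ) - 1) ^ (2 * n)`. -/
theorem sum_centralCoeff_mul_cos (n : ℕ) (θ : ℝ) :
    ∑ k ∈ Finset.range (2 * n + 1), centralCoeff n k * Real.cos ((k - n) * θ) =
      (2 - 2 * Real.cos θ) ^ n := by
  have h : ∑ k ∈ Finset.range (2 * n + 1),
      (centralCoeff n k : ℂ) * Complex.exp ((k - n) * (θ * Complex.I)) =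
        (2 - 2 * Complex.cos θ) ^ n := by
    have hbin : ∑ k ∈ Finset.range (2 * n + 1),
        (centralCoeff n k : ℂ) * Complex.exp ((k - n) * (θ * Complex.I)) =
        (-1) ^ n * Complex.exp (-(n * (θ * Complex.I))) *
          (Complex.exp (θ * Complex.I) + (-1)) ^ (2 * n) := by
      rw [add_pow, Finset.mul_sum]
      refine Finset.sum_congr rfl fun k _ => ?_
      rw [centralCoeff, sub_mul, sub_eq_add_neg, Complex.exp_add, Complex.exp_nat_mul]
      push_cast
      ring
    rw [hbin, pow_mul, ← mul_neg, Complex.exp_nat_mul, ← mul_pow, ← mul_pow]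
    congr 1
    have h1 : Complex.exp (-(θ * Complex.I)) * Complex.exp (θ * Complex.I) = 1 := by
      rw [← Complex.exp_add]; simp
    rw [Complex.cos, neg_mul (θ : ℂ)]
    linear_combination (-Complex.exp (θ * Complex.I) + 2) * h1
  have h' := congrArg Complex.re h
  rw [Complex.re_sum] at h'
  have hr : ((2 - 2 * Complex.cos θ) ^ n : ℂ) = (((2 - 2 * Real.cos θ) ^ n : ℝ) : ℂ) := by
    push_cast; rfl
  rw [hr, Complex.ofReal_re] at h'
  rw [← h']
  refine Finset.sum_congr rfl fun k _ => ?_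
  rw [Complex.re_ofReal_mul]
  have : ((k : ℂ) - n) * (θ * Complex.I) = (((k - n) * θ : ℝ) : ℂ) * Complex.I := by
    push_cast; ring
  rw [this, Complex.exp_ofReal_mul_I_re]

theorem sum_centralCoeff_mul_pow_of_lt {m n : ℕ} (h : m < n) :
    ∑ k ∈ Finset.range (2 * n + 1), centralCoeff n k * ((k : ℝ) - n) ^ (2 * m) = 0 := by
  rw [sum_centralCoeff_mul n (fun r => r ^ (2 * m)),
    fwdDiff_iter_pow_eq_zero_of_lt (by lia)]
  simp

theorem sum_centralCoeff_mul_pow_self (n : ℕ) :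
    ∑ k ∈ Finset.range (2 * n + 1), centralCoeff n k * ((k : ℝ) - n) ^ (2 * n) =
      (-1) ^ n * (2 * n).factorial := by
  rw [sum_centralCoeff_mul n (fun r => r ^ (2 * n)), fwdDiff_iter_eq_factorial]
  simp

/-- The central difference of order `2 * n` of an even entire power series, divided by
`t ^ (2 * n)`, tends to `± (2 * n).factorial` times the coefficient of order `2 * n`. -/
theorem tendsto_centralDifference {a : ℕ → ℝ} {f : ℝ → ℝ}
    (ha : ∀ r : ℝ, Summable fun m => |a m| * r ^ (2 * m))
    (hf : ∀ t, HasSum (fun m => a m * t ^ (2 * m)) (f t)) (n : ℕ) :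
    Tendsto (fun t : ℝ => (∑ k ∈ Finset.range (2 * n + 1), centralCoeff n k * f ((k - n) * t)) /
      t ^ (2 * n)) (𝓝[≠] 0) (𝓝 ((-1) ^ n * a n * (2 * n).factorial)) := by
  set w : ℕ → ℝ := fun m =>
    ∑ k ∈ Finset.range (2 * n + 1), centralCoeff n k * ((k : ℝ) - n) ^ (2 * m) with hw
  set C : ℝ := ∑ k ∈ Finset.range (2 * n + 1), |centralCoeff n k|
  have hwb : ∀ m, |w m| ≤ C * (n : ℝ) ^ (2 * m) := by
    intro m
    refine (Finset.abs_sum_le_sum_abs _ _).trans ?_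
    rw [Finset.sum_mul]
    refine Finset.sum_le_sum fun k hk => ?_
    rw [abs_mul, abs_pow]
    have hk' : (k : ℝ) ≤ 2 * n := by
      have := Finset.mem_range.1 hk
      exact_mod_cast (by lia : k ≤ 2 * n)
    have : |(k : ℝ) - n| ≤ n := abs_le.2 ⟨by linarith [Nat.cast_nonneg (α := ℝ) k], by linarith⟩
    gcongr
  have hsum : ∀ t : ℝ, HasSum (fun m => a m * w m * t ^ (2 * m))
      (∑ k ∈ Finset.range (2 * n + 1), centralCoeff n k * f ((k - n) * t)) := by
    intro t
    have := hasSum_sum (s := Finset.range (2 * n + 1)) fun k _ =>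
      (hf (((k : ℝ) - n) * t)).mul_left (centralCoeff n k)
    refine this.congr_fun fun m => ?_
    rw [hw, Finset.mul_sum, Finset.sum_mul]
    refine Finset.sum_congr rfl fun k _ => ?_
    rw [mul_pow]; ring
  -- The terms of index below `n` vanish, so the power `t ^ (2 * n)` can be divided out.
  have hshift : ∀ t : ℝ, t ≠ 0 →
      (∑ k ∈ Finset.range (2 * n + 1), centralCoeff n k * f ((k - n) * t)) / t ^ (2 * n) =
        ∑' m, a (m + n) * w (m + n) * t ^ (2 * m) := by
    intro t ht
    have h1 : HasSum (fun m => a (m + n) * w (m + n) * t ^ (2 * (m + n)))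
        (∑ k ∈ Finset.range (2 * n + 1), centralCoeff n k * f ((k - n) * t)) := by
      have h0 : ∑ m ∈ Finset.range n, a m * w m * t ^ (2 * m) = 0 :=
        Finset.sum_eq_zero fun m hm => by
          simp only [hw]
          rw [sum_centralCoeff_mul_pow_of_lt (Finset.mem_range.1 hm)]
          ring
      have := (hasSum_nat_add_iff' n).2 (hsum t)
      rwa [h0, sub_zero] at this
    rw [← (h1.div_const (t ^ (2 * n))).tsum_eq]
    refine tsum_congr fun m => ?_
    rw [mul_add, pow_add]
    field_simp
  have hlim : Tendsto (fun t : ℝ => ∑' m, a (m + n) * w (m + n) * t ^ (2 * m)) (𝓝[≠] 0)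
      (𝓝 (∑' m, a (m + n) * w (m + n) * (0 : ℝ) ^ (2 * m))) := by
    refine tendsto_tsum_of_dominated_convergence
      (bound := fun m => C * (|a (m + n)| * (n : ℝ) ^ (2 * (m + n)))) ?_ ?_ ?_
    · exact ((summable_nat_add_iff n).2 (ha n)).mul_left C
    · intro m
      refine Tendsto.mono_left ?_ nhdsWithin_le_nhds
      exact Continuous.tendsto (by fun_prop) 0
    · have : ∀ᶠ t : ℝ in 𝓝[≠] 0, |t| < 1 := by
        refine nhdsWithin_le_nhds ?_
        filter_upwards [Metric.ball_mem_nhds (0 : ℝ) one_pos] with t ht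
        simpa using ht
      filter_upwards [this] with t ht m
      rw [Real.norm_eq_abs, abs_mul, abs_mul, abs_pow]
      calc |a (m + n)| * |w (m + n)| * |t| ^ (2 * m)
          ≤ |a (m + n)| * (C * (n : ℝ) ^ (2 * (m + n))) * 1 := by
            gcongr
            · exact hwb _
            · exact pow_le_one₀ (abs_nonneg t) ht.le
        _ = _ := by ring
  have hval : ∑' m, a (m + n) * w (m + n) * (0 : ℝ) ^ (2 * m) =
      (-1) ^ n * a n * (2 * n).factorial := by
    rw [tsum_eq_single 0 fun m hm => by simp [hm]]
    simp only [zero_add, mul_zero, pow_zero, mul_one]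
    simp only [hw]
    rw [sum_centralCoeff_mul_pow_self]
    ring
  rw [hval] at hlim
  refine hlim.congr' ?_
  filter_upwards [self_mem_nhdsWithin] with t ht
  exact (hshift t ht).symm

/-- By `2 - 2 cos (t x) = (2 sin (t x / 2)) ^ 2`, the limit is the square of a derivative at `0`. -/
theorem tendsto_two_sub_two_mul_cos_div (x : ℝ) :
    Tendsto (fun t : ℝ => (2 - 2 * Real.cos (t * x)) / t ^ 2) (𝓝[≠] 0) (𝓝 (x ^ 2)) := by
  have h : HasDerivAt (fun t : ℝ => 2 * Real.sin (t / 2 * x)) x 0 := by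
    have := (((hasDerivAt_id (0 : ℝ)).div_const 2).mul_const x).sin.const_mul 2
    refine this.congr_deriv ?_
    simp
  have h2 := (hasDerivAt_iff_tendsto_slope_zero.1 h).pow 2
  refine h2.congr fun t => ?_
  have hc : Real.cos (t * x) = 1 - 2 * Real.sin (t / 2 * x) ^ 2 := by
    rw [show t * x = 2 * (t / 2 * x) by ring, Real.cos_two_mul, Real.cos_sq']
    ring
  simp [hc, mul_pow, div_eq_mul_inv]
  ring

section ExponentialMoments

variable {Ω : Type*} [MeasurableSpace Ω] {μ : Measure Ω}

/-- If the characteristic function of `X` is an even entire power series, Fatou's lemma applied to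
`((2 - 2 * cos (t * X)) / t ^ 2) ^ n` as `t → 0` bounds the moment of order `2 * n`. -/
theorem lintegral_pow_two_mul_le [IsFiniteMeasure μ] {X : Ω → ℝ} (hX : Measurable X) {a : ℕ → ℝ}
    (ha : ∀ r : ℝ, Summable fun m => |a m| * r ^ (2 * m))
    (hf : ∀ t : ℝ, HasSum (fun m => a m * t ^ (2 * m)) (∫ ω, Real.cos (t * X ω) ∂μ)) (n : ℕ) :
    ∫⁻ ω, ENNReal.ofReal (X ω ^ (2 * n)) ∂μ ≤ ENNReal.ofReal (|a n| * (2 * n).factorial) := by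
  have hcos : ∀ t : ℝ, Integrable (fun ω => Real.cos (t * X ω)) μ := fun t =>
    Integrable.of_bound (by fun_prop) 1 (ae_of_all _ fun ω => by
      simpa using Real.abs_cos_le_one (t * X ω))
  have hpos : ∀ θ t : ℝ, 0 ≤ ((2 - 2 * Real.cos θ) / t ^ 2) ^ n := fun θ t =>
    pow_nonneg (div_nonneg (by linarith [Real.cos_le_one θ]) (sq_nonneg t)) n
  have hexp : ∀ t ω : ℝ, ((2 - 2 * Real.cos (t * ω)) / t ^ 2) ^ n =
      (∑ k ∈ Finset.range (2 * n + 1), centralCoeff n k * Real.cos ((k - n) * t * ω)) /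
        t ^ (2 * n) := by
    intro t ω
    rw [div_pow, ← sum_centralCoeff_mul_cos, pow_mul]
    simp only [mul_assoc]
  have hterm : ∀ t : ℝ, ∀ k ∈ Finset.range (2 * n + 1),
      Integrable (fun ω => centralCoeff n k * Real.cos ((k - n) * t * X ω)) μ :=
    fun t k _ => (hcos _).const_mul _
  have hint : ∀ t : ℝ, ∫⁻ ω, ENNReal.ofReal (((2 - 2 * Real.cos (t * X ω)) / t ^ 2) ^ n) ∂μ =
      ENNReal.ofReal ((∑ k ∈ Finset.range (2 * n + 1),
        centralCoeff n k * ∫ ω, Real.cos ((k - n) * t * X ω) ∂μ) / t ^ (2 * n)) := by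
    intro t
    rw [← ofReal_integral_eq_lintegral_ofReal _ (ae_of_all _ fun ω => hpos _ _)]
    · simp only [hexp]
      rw [integral_div, integral_finsetSum _ (hterm t)]
      simp only [integral_const_mul]
    · simp only [hexp]
      exact (integrable_finsetSum _ (hterm t)).div_const _
  have hlim := ENNReal.tendsto_ofReal (tendsto_centralDifference ha hf n)
  calc ∫⁻ ω, ENNReal.ofReal (X ω ^ (2 * n)) ∂μ
      = ∫⁻ ω, liminf (fun t : ℝ =>
          ENNReal.ofReal (((2 - 2 * Real.cos (t * X ω)) / t ^ 2) ^ n)) (𝓝[≠] 0) ∂μ := by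
        refine lintegral_congr fun ω => ?_
        rw [pow_mul]
        exact (ENNReal.tendsto_ofReal
          ((tendsto_two_sub_two_mul_cos_div (X ω)).pow n)).liminf_eq.symm
    _ ≤ liminf (fun t : ℝ => ∫⁻ ω,
          ENNReal.ofReal (((2 - 2 * Real.cos (t * X ω)) / t ^ 2) ^ n) ∂μ) (𝓝[≠] 0) :=
        lintegral_liminf_le fun t => by fun_prop
    _ = ENNReal.ofReal ((-1) ^ n * a n * (2 * n).factorial) := by
        simp only [hint]
        exact hlim.liminf_eq
    _ ≤ _ := by
        refine ENNReal.ofReal_le_ofReal ?_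
        gcongr
        calc (-1) ^ n * a n ≤ |(-1) ^ n * a n| := le_abs_self _
          _ = |a n| := by simp [abs_mul]

/-- The moment bounds make the series `∑ E (c X) ^ (2 * n) / (2 * n)!` for the expectation of
`cosh (c X)` converge. -/
theorem integrable_exp_mul_abs_of_hasSum [IsFiniteMeasure μ] {X : Ω → ℝ} (hX : Measurable X)
    {a : ℕ → ℝ} (ha : ∀ r : ℝ, Summable fun m => |a m| * r ^ (2 * m))
    (hf : ∀ t : ℝ, HasSum (fun m => a m * t ^ (2 * m)) (∫ ω, Real.cos (t * X ω) ∂μ)) (c : ℝ) :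
    Integrable (fun ω => Real.exp (c * |X ω|)) μ := by
  have hfin : ∫⁻ ω, ENNReal.ofReal (Real.cosh (c * X ω)) ∂μ < ⊤ := by
    have h1 : ∀ ω, ENNReal.ofReal (Real.cosh (c * X ω)) =
        ∑' n : ℕ, ENNReal.ofReal (c ^ (2 * n) / (2 * n).factorial) *
          ENNReal.ofReal (X ω ^ (2 * n)) := by
      intro ω
      have hnn : ∀ n : ℕ, ∀ y : ℝ, 0 ≤ y ^ (2 * n) := fun n y => (even_two_mul n).pow_nonneg y
      have hs := Real.hasSum_cosh (c * X ω)
      rw [← hs.tsum_eq, ENNReal.ofReal_tsum_of_nonneg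
        (fun n => div_nonneg (hnn n _) (by positivity)) hs.summable]
      refine tsum_congr fun n => ?_
      rw [← ENNReal.ofReal_mul (div_nonneg (hnn n c) (by positivity)), mul_pow]
      congr 1
      ring
    simp only [h1]
    rw [lintegral_tsum fun n => by fun_prop]
    calc ∑' n : ℕ, ∫⁻ ω, ENNReal.ofReal (c ^ (2 * n) / (2 * n).factorial) *
            ENNReal.ofReal (X ω ^ (2 * n)) ∂μ
        ≤ ∑' n : ℕ, ENNReal.ofReal (|a n| * c ^ (2 * n)) := by
          refine ENNReal.tsum_le_tsum fun n => ?_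
          have hc : 0 ≤ c ^ (2 * n) := (even_two_mul n).pow_nonneg c
          rw [lintegral_const_mul _ (by fun_prop)]
          refine (mul_le_mul_right (lintegral_pow_two_mul_le hX ha hf n) _).trans ?_
          rw [← ENNReal.ofReal_mul (by positivity)]
          refine ENNReal.ofReal_le_ofReal (le_of_eq ?_)
          field_simp
      _ < ⊤ := (ha c).tsum_ofReal_lt_top
  have hcosh : Integrable (fun ω => Real.cosh (c * X ω)) μ :=
    ⟨by fun_prop, by
      rwa [hasFiniteIntegral_iff_ofReal (ae_of_all _ fun ω => (Real.cosh_pos _).le)]⟩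
  -- `exp (c |x|)` is one of the two summands of `2 cosh (c x)`.
  refine (hcosh.const_mul 2).mono' (by fun_prop) (ae_of_all _ fun ω => ?_)
  rw [Real.norm_of_nonneg (Real.exp_pos _).le, Real.cosh_eq]
  have h1 := Real.exp_pos (c * X ω)
  have h2 := Real.exp_pos (-(c * X ω))
  rcases abs_cases (X ω) with ⟨h, _⟩ | ⟨h, _⟩ <;> rw [h]
  · linarith
  · rw [mul_neg]; linarith

/-! ### Analytic dependence of exponential integrals -/

theorem differentiable_integral_exp [IsFiniteMeasure μ] {X Y : Ω → ℝ} (hX : Measurable X)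
    (hY : Measurable Y) (hexp : ∀ c : ℝ, Integrable (fun ω => Real.exp (c * |X ω|)) μ) :
    Differentiable ℂ fun z : ℂ =>
      ∫ ω, Complex.exp (z * (X ω : ℂ) + Complex.I * (Y ω : ℂ)) ∂μ := by
  intro z₀
  have hnorm : ∀ (z : ℂ) ω, ‖Complex.exp (z * (X ω : ℂ) + Complex.I * (Y ω : ℂ))‖ ≤
      Real.exp (‖z‖ * |X ω|) := by
    intro z ω
    rw [Complex.norm_exp]
    refine Real.exp_le_exp.2 ?_
    simp only [Complex.add_re, Complex.re_mul_ofReal, Complex.I_re, zero_mul, add_zero]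
    calc z.re * X ω ≤ |z.re * X ω| := le_abs_self _
      _ = |z.re| * |X ω| := abs_mul _ _
      _ ≤ _ := by gcongr; exact Complex.abs_re_le_norm z
  -- On the unit ball around `z₀` the derivative is at most `|X| exp ((‖z₀‖ + 1) |X|)`, and
  -- `|X| ≤ exp |X|`.
  refine (hasDerivAt_integral_of_dominated_loc_of_deriv_le
    (F' := fun z ω => Complex.exp (z * (X ω : ℂ) + Complex.I * (Y ω : ℂ)) * (X ω : ℂ))
    (bound := fun ω => Real.exp ((‖z₀‖ + 2) * |X ω|))
    (Metric.ball_mem_nhds z₀ one_pos) (Eventually.of_forall fun z => by fun_prop)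
    ((hexp ‖z₀‖).mono' (by fun_prop) (ae_of_all _ (hnorm z₀))) (by fun_prop)
    (ae_of_all _ fun ω z hz => ?_) (hexp _) (ae_of_all _ fun ω z _ => ?_)).2.differentiableAt
  · have hz' : ‖z‖ ≤ ‖z₀‖ + 1 := by
      have h1 := norm_sub_norm_le z z₀
      have h2 := mem_ball_iff_norm.1 hz
      linarith
    rw [norm_mul, Complex.norm_real, Real.norm_eq_abs]
    calc ‖Complex.exp (z * (X ω : ℂ) + Complex.I * (Y ω : ℂ))‖ * |X ω|
        ≤ Real.exp ((‖z₀‖ + 1) * |X ω|) * Real.exp |X ω| := by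
          gcongr
          · exact (hnorm z ω).trans (by gcongr)
          · linarith [Real.add_one_le_exp |X ω|]
      _ = _ := by rw [← Real.exp_add]; ring_nf
  · have := (((hasDerivAt_id z).mul_const (X ω : ℂ)).add_const
      (Complex.I * (Y ω : ℂ))).cexp
    simpa using this

end ExponentialMoments

/-! ### The bilinear form `∫ f g` on Schwartz functions -/

theorem integrable_mul_schwartz {𝕜 : Type*} [RCLike 𝕜] (f g : 𝓢(ℝ, 𝕜)) :
    Integrable (fun x => f x * g x) :=
  (f.memLp 2).integrable_mul (g.memLp 2)

/-- `∫ f²` is the `L²` inner product of `conj f` and `f`, and the embedding of the Schwartz space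
into `L²` is continuous. -/
theorem continuous_integral_sq :
    Continuous fun f : 𝓢(ℝ, ℂ) => ∫ x, f x * f x := by
  have h : (fun f : 𝓢(ℝ, ℂ) => ∫ x, f x * f x) = fun f => inner ℂ
      ((f.postcompCLM (Complex.conjCLE : ℂ →L[ℝ] ℂ)).toLp 2 volume) (f.toLp 2 volume) := by
    funext f
    rw [SchwartzMap.inner_toL2_toL2_eq _ _ volume]
    refine integral_congr_ae (ae_of_all _ fun x => ?_)
    simp
  rw [h]
  exact ((SchwartzMap.continuous_toLp).comp (ContinuousLinearMap.continuous _)).inner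
    SchwartzMap.continuous_toLp

theorem integral_sq_add_smul {𝕜 : Type*} [RCLike 𝕜] (f g : 𝓢(ℝ, 𝕜)) (z : 𝕜) :
    ∫ x, (f + z • g) x * (f + z • g) x =
      (∫ x, f x * f x) + 2 * z * (∫ x, f x * g x) + z ^ 2 * ∫ x, g x * g x := by
  have h : ∀ x, (f + z • g) x * (f + z • g) x =
      f x * f x + 2 * z * (f x * g x) + z ^ 2 * (g x * g x) := by
    intro x
    simp only [add_apply, smul_apply, smul_eq_mul]
    ring
  simp only [h]
  have h1 := integrable_mul_schwartz f f
  have h2 := (integrable_mul_schwartz f g).const_mul (2 * z)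
  have h3 := (integrable_mul_schwartz g g).const_mul (z ^ 2)
  rw [integral_add (h1.fun_add h2) h3, integral_add h1 h2, integral_const_mul, integral_const_mul]

theorem integral_sq_eq_re_im (f : 𝓢(ℝ, ℂ)) :
    ∫ x, f x * f x =
      ((∫ x, f.postcompCLM Complex.reCLM x * f.postcompCLM Complex.reCLM x : ℝ) : ℂ) +
      2 * Complex.I *
        ((∫ x, f.postcompCLM Complex.reCLM x * f.postcompCLM Complex.imCLM x : ℝ) : ℂ) -
      ((∫ x, f.postcompCLM Complex.imCLM x * f.postcompCLM Complex.imCLM x : ℝ) : ℂ) := by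
  set u := f.postcompCLM Complex.reCLM with hu
  set v := f.postcompCLM Complex.imCLM with hv
  have h : ∀ x, f x * f x = ((u x * u x : ℝ) : ℂ) + 2 * Complex.I * ((u x * v x : ℝ) : ℂ) -
      ((v x * v x : ℝ) : ℂ) := by
    intro x
    have hx : f x = (u x : ℂ) + Complex.I * (v x : ℂ) := by
      simp [hu, hv, mul_comm Complex.I, Complex.re_add_im]
    rw [hx]
    push_cast
    linear_combination (v x : ℂ) ^ 2 * Complex.I_sq
  simp only [h]
  have h1 : Integrable fun x => ((u x * u x : ℝ) : ℂ) := (integrable_mul_schwartz u u).ofReal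
  have h2 : Integrable fun x => 2 * Complex.I * ((u x * v x : ℝ) : ℂ) :=
    (integrable_mul_schwartz u v).ofReal.const_mul _
  have h3 : Integrable fun x => ((v x * v x : ℝ) : ℂ) := (integrable_mul_schwartz v v).ofReal
  rw [integral_sub (h1.fun_add h2) h3, integral_add h1 h2, integral_const_mul]
  simp only [integral_complex_ofReal]

/-! ### The one-dimensional Laplace transform -/

variable {β : ℝ} {μ : Measure Distr}

theorem IsMittagLefflerMeasure.hasSum_integral_cos (hβ : 0 < β) (hμ : IsMittagLefflerMeasure β μ)
    (φ : Test) (t : ℝ) :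
    HasSum (fun m : ℕ => (-(1 / 2) * ∫ x, φ x * φ x) ^ m / Real.Gamma (β * m + 1) * t ^ (2 * m))
      (∫ ω, Real.cos (t * ω φ) ∂μ) := by
  have := hμ.1
  set s : ℝ := -(1 / 2) * ∫ x, φ x * φ x with hs
  have hsum : Summable fun m : ℕ => s ^ m / Real.Gamma (β * m + 1) * t ^ (2 * m) := by
    refine .of_norm ((summable_pow_div_Gamma hβ (r := |s * t ^ 2|) (abs_nonneg _)).congr
      fun m => ?_)
    rw [norm_mul, norm_div, Real.norm_of_nonneg (Gamma_mul_natCast_add_one_pos hβ m).le,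
      norm_pow, norm_pow, Real.norm_eq_abs, Real.norm_eq_abs, abs_mul, abs_pow, mul_pow, ← pow_mul]
    ring
  have hint : Integrable (fun ω : Distr => Complex.exp (Complex.I * ((t * ω φ : ℝ) : ℂ))) μ := by
    refine Integrable.of_bound (((measurable_eval φ).const_mul t).complex_ofReal.const_mul
      Complex.I).cexp.aestronglyMeasurable 1 (ae_of_all _ fun ω => ?_)
    rw [Complex.norm_exp]
    simp
  have h := hμ.2 (t • φ)
  have hq : -(1 / 2) * ∫ x, (t • φ) x * (t • φ) x = s * t ^ 2 := by
    have h0 := integral_sq_add_smul (0 : Test) φ t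
    simp only [zero_add] at h0
    rw [h0, hs]
    simp
    ring
  have hre : ∫ ω, Real.cos (t * ω φ) ∂μ =
      ∑' m : ℕ, s ^ m / Real.Gamma (β * m + 1) * t ^ (2 * m) := by
    rw [hq] at h
    have h' := congrArg Complex.re h
    simp only [map_smul, smul_eq_mul] at h'
    have hre := integral_re hint
    simp only [RCLike.re_to_complex] at hre
    rw [← hre] at h'
    have hc : ∀ ω : Distr, (Complex.exp (Complex.I * ((t * ω φ : ℝ) : ℂ))).re =
        Real.cos (t * ω φ) := fun ω => by
      rw [mul_comm, Complex.exp_ofReal_mul_I_re]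
    simp only [hc] at h'
    rw [h', mittagLeffler]
    have : ∀ m : ℕ, ((s * t ^ 2 : ℝ) : ℂ) ^ m / (Real.Gamma (β * m + 1) : ℂ) =
        ((s ^ m / Real.Gamma (β * m + 1) * t ^ (2 * m) : ℝ) : ℂ) := by
      intro m
      push_cast
      rw [mul_pow, ← pow_mul]
      ring
    simp only [this]
    rw [← Complex.ofReal_tsum, Complex.ofReal_re]
  rw [hre]
  exact hsum.hasSum

theorem IsMittagLefflerMeasure.integrable_exp_mul_abs (hβ : 0 < β)
    (hμ : IsMittagLefflerMeasure β μ) (φ : Test) (c : ℝ) :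
    Integrable (fun ω : Distr => Real.exp (c * |ω φ|)) μ := by
  have := hμ.1
  refine integrable_exp_mul_abs_of_hasSum (measurable_eval φ) (fun r => ?_)
    (hμ.hasSum_integral_cos hβ φ) c
  refine (hμ.hasSum_integral_cos hβ φ r).summable.norm.congr fun m => ?_
  rw [norm_mul, Real.norm_eq_abs, Real.norm_of_nonneg ((even_two_mul m).pow_nonneg r)]

theorem IsMittagLefflerMeasure.integrable_exp (hβ : 0 < β)
    (hμ : IsMittagLefflerMeasure β μ) (φ ψ : Test) :
    Integrable (fun ω : Distr => Complex.exp ((ω φ : ℂ) + Complex.I * (ω ψ : ℂ))) μ := by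
  have hmeas : Measurable fun ω : Distr => Complex.exp ((ω φ : ℂ) + Complex.I * (ω ψ : ℂ)) :=
    ((measurable_eval φ).complex_ofReal.add
      ((measurable_eval ψ).complex_ofReal.const_mul Complex.I)).cexp
  refine (hμ.integrable_exp_mul_abs hβ φ 1).mono' hmeas.aestronglyMeasurable
    (ae_of_all _ fun ω => ?_)
  rw [Complex.norm_exp]
  simpa using le_abs_self (ω φ)

/-- The characteristic function determines the Laplace transform by analytic continuation: with
`φ` replaced by `z φ`, both sides are entire functions of `z` that agree on the imaginary axis. -/
theorem IsMittagLefflerMeasure.integral_exp (hβ : 0 < β)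
    (hμ : IsMittagLefflerMeasure β μ) (f : 𝓢(ℝ, ℂ)) :
    ∫ ω : Distr, Complex.exp ((ω (f.postcompCLM Complex.reCLM) : ℂ) +
      Complex.I * (ω (f.postcompCLM Complex.imCLM) : ℂ)) ∂μ =
        mittagLeffler β (1 / 2 * ∫ x, f x * f x) := by
  have := hμ.1
  rw [integral_sq_eq_re_im]
  set u : Test := f.postcompCLM Complex.reCLM
  set v : Test := f.postcompCLM Complex.imCLM
  set A : ℝ := ∫ x, u x * u x with hA
  set B : ℝ := ∫ x, u x * v x with hB
  set C : ℝ := ∫ x, v x * v x with hC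
  have hL := differentiable_integral_exp (measurable_eval u) (measurable_eval v)
    (hμ.integrable_exp_mul_abs hβ u)
  have hR : Differentiable ℂ fun z : ℂ =>
      mittagLeffler β (1 / 2 * (z ^ 2 * A + 2 * Complex.I * z * B - C)) :=
    (differentiable_mittagLeffler hβ).comp (by fun_prop)
  have hfreq : ∃ᶠ z in 𝓝[≠] (0 : ℂ),
      ∫ ω : Distr, Complex.exp (z * (ω u : ℂ) + Complex.I * (ω v : ℂ)) ∂μ =
        mittagLeffler β (1 / 2 * (z ^ 2 * A + 2 * Complex.I * z * B - C)) := by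
    have hmap : Tendsto (fun t : ℝ => Complex.I * (t : ℂ)) (𝓝[≠] 0) (𝓝[≠] 0) := by
      refine tendsto_nhdsWithin_iff.2 ⟨?_, ?_⟩
      · refine Tendsto.mono_left ?_ nhdsWithin_le_nhds
        have : Continuous fun t : ℝ => Complex.I * (t : ℂ) := by fun_prop
        simpa using this.tendsto 0
      · filter_upwards [self_mem_nhdsWithin] with t ht
        have ht' : t ≠ 0 := ht
        simp [ht']
    refine hmap.frequently (Eventually.of_forall fun t => ?_).frequently
    have h := hμ.2 (v + t • u)
    rw [integral_sq_add_smul] at h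
    have hcomm : ∫ x, v x * u x = B := by simp only [hB, mul_comm]
    rw [hcomm, ← hA, ← hC] at h
    convert h using 2
    · funext ω
      simp only [map_add, map_smul, smul_eq_mul]
      push_cast
      ring_nf
    · push_cast
      linear_combination (1 / 2 * (t : ℂ) ^ 2 * A + t * B) * Complex.I_sq
  have hEq := AnalyticOnNhd.eq_of_frequently_eq (fun z _ => hL.analyticAt z)
    (fun z _ => hR.analyticAt z) hfreq
  simpa using congrFun hEq 1

/-! ### The product measure -/

theorem measurable_eval_distrD {d : ℕ} (φ : TestD d) : Measurable fun ω : DistrD d => ω φ := by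
  refine Measurable.of_comap_le ?_
  rw [BorelSpace.measurable_eq (α := ℝ)]
  exact le_iSup (fun φ : TestD d =>
    MeasurableSpace.comap (fun ω : DistrD d => ω φ) (borel ℝ)) φ

theorem measurable_exp_pairing {d : ℕ} (φ : TestDC d) :
    Measurable fun ω : DistrD d => Complex.exp (pairing ω φ) :=
  ((measurable_eval_distrD (rePart φ)).complex_ofReal.add
    ((measurable_eval_distrD (imPart φ)).complex_ofReal.const_mul Complex.I)).cexp

theorem exp_pairing_ofComponents {d : ℕ} (ω : Fin d → Distr) (φ : TestDC d) :
    Complex.exp (pairing (ofComponents d ω) φ) =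
      ∏ k, Complex.exp ((ω k ((φ k).postcompCLM Complex.reCLM) : ℂ) +
        Complex.I * (ω k ((φ k).postcompCLM Complex.imCLM) : ℂ)) := by
  rw [← Complex.exp_sum, pairing, ofComponents_apply, ofComponents_apply]
  push_cast
  rw [Finset.sum_add_distrib, Finset.mul_sum]
  rfl

theorem IsMittagLefflerMeasure.integrable_exp_pairing {d : ℕ} (hβ : 0 < β)
    (hμ : IsMittagLefflerMeasure β μ) (φ : TestDC d) :
    Integrable (fun ω : DistrD d => Complex.exp (pairing ω φ)) (productMeasure d μ) := by
  have := hμ.1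
  rw [productMeasure, integrable_map_measure
    (measurable_exp_pairing φ).aestronglyMeasurable (measurable_ofComponents d).aemeasurable]
  simp only [Function.comp_def, exp_pairing_ofComponents]
  exact Integrable.fintype_prod fun k => hμ.integrable_exp hβ _ _

/-- The Laplace transform of `μ_β^{⊗d}` in closed form. -/
theorem IsMittagLefflerMeasure.laplaceTransform_productMeasure {d : ℕ} (hβ : 0 < β)
    (hμ : IsMittagLefflerMeasure β μ) :
    laplaceTransform (productMeasure d μ) =
      fun φ => ∏ k, mittagLeffler β (1 / 2 * ∫ x, φ k x * φ k x) := by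
  have := hμ.1
  funext φ
  rw [laplaceTransform, productMeasure, integral_map (measurable_ofComponents d).aemeasurable
    (measurable_exp_pairing φ).aestronglyMeasurable]
  simp only [exp_pairing_ofComponents]
  rw [integral_fintype_prod_eq_prod (μ := fun _ : Fin d => μ)
    (fun k (ω : Distr) => Complex.exp ((ω ((φ k).postcompCLM Complex.reCLM) : ℂ) +
        Complex.I * (ω ((φ k).postcompCLM Complex.imCLM) : ℂ)))]
  exact Finset.prod_congr rfl fun k _ => hμ.integral_exp hβ (φ k)

theorem IsMittagLefflerMeasure.continuous_laplaceTransform {d : ℕ} (hβ : 0 < β)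
    (hμ : IsMittagLefflerMeasure β μ) :
    Continuous (laplaceTransform (productMeasure d μ)) := by
  rw [hμ.laplaceTransform_productMeasure hβ]
  refine continuous_finsetProd _ fun k _ => (differentiable_mittagLeffler hβ).continuous.comp ?_
  exact continuous_const.mul (continuous_integral_sq.comp (continuous_apply k))

theorem IsMittagLefflerMeasure.differentiable_laplaceTransform_line {d : ℕ} (hβ : 0 < β)
    (hμ : IsMittagLefflerMeasure β μ) (φ ψ : TestDC d) :
    Differentiable ℂ fun z : ℂ => laplaceTransform (productMeasure d μ) (φ + z • ψ) := by
  rw [hμ.laplaceTransform_productMeasure hβ]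
  refine Differentiable.fun_finsetProd fun k _ => (differentiable_mittagLeffler hβ).comp ?_
  simp only [Pi.add_apply, Pi.smul_apply, integral_sq_add_smul]
  fun_prop

end MittagLeffler

theorem mainTheorem9 (d : ℕ) (hd : 1 ≤ d) (β : ℝ) (hβ0 : 0 < β) (hβ1 : β ≤ 1)
    (μ : MeasureTheory.Measure MittagLeffler.Distr)
    (hμ : MittagLeffler.IsMittagLefflerMeasure β μ) :
    (∀ φ : MittagLeffler.TestDC d,
      MeasureTheory.Integrable
        (fun ω : MittagLeffler.DistrD d => Complex.exp (MittagLeffler.pairing ω φ))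
        (MittagLeffler.productMeasure d μ)) ∧
    MittagLeffler.LocallyBoundedOn
      (MittagLeffler.laplaceTransform (MittagLeffler.productMeasure d μ)) Set.univ ∧
    MittagLeffler.GHolomorphicOn
      (MittagLeffler.laplaceTransform (MittagLeffler.productMeasure d μ)) Set.univ ∧
    MittagLeffler.HolomorphicOn
      (MittagLeffler.laplaceTransform (MittagLeffler.productMeasure d μ)) Set.univ ∧
    MittagLeffler.HasAnalyticLaplaceTransform (MittagLeffler.productMeasure d μ) := by
  have hint := hμ.integrable_exp_pairing (d := d) hβ0
  have hcont := hμ.continuous_laplaceTransform (d := d) hβ0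
  have hG : MittagLeffler.GHolomorphicOn
      (MittagLeffler.laplaceTransform (MittagLeffler.productMeasure d μ)) Set.univ :=
    fun φ _ ψ => ⟨Set.univ, isOpen_univ, Set.mem_univ _, fun _ _ => Set.mem_univ _,
      (hμ.differentiable_laplaceTransform_line hβ0 φ ψ).differentiableOn⟩
  have hH : MittagLeffler.HolomorphicOn
      (MittagLeffler.laplaceTransform (MittagLeffler.productMeasure d μ)) Set.univ :=
    ⟨isOpen_univ, hG, hcont.continuousOn⟩
  refine ⟨hint, fun φ _ => ?_, hG, hH, Set.univ, Set.mem_univ _, fun φ _ => hint φ, hH⟩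
  refine ⟨‖MittagLeffler.laplaceTransform (MittagLeffler.productMeasure d μ) φ‖ + 1, ?_⟩
  rw [nhdsWithin_univ]
  filter_upwards [hcont.norm.continuousAt.eventually_lt continuousAt_const (lt_add_one _)]
    with ψ hψ using hψ.le
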